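/- **Setting.** Let $K\subset\mathbb R^3$ be a tame oriented knot, $n(K)$ an open solid torus neighbourhood of $K$, and $\pi_K=\pi_1(\mathbb R^3\setminus n(K))$ the knot group, based at a point of the boundary torus. Let $m\in\pi_K$ be a meridian (the class of the boundary of a meridian disc of $n(K)$, with either orientation) and $\ell\in\pi_K$ the preferred longitude (the longitude on the boundary torus that is null-homologous in the exterior). Put $R_0=\mathbb Z[\lambda^{\pm1},\mu^{\pm1}]$. The cord algebra $\mathcal C_K$ is the noncommutative unital $R_0$-algebra generated freely by symbols $[\gamma]$, $\gamma\in\pi_K$, modulo the relations 1. $[e]=1-\mu$; 2. $[m\gamma]=[\gamma m]=\mu[\gamma]$ and $[\ell\gamma]=[\gamma\ell]=\lambda[\gamma]$ for $\gamma\in\pi_K$; 3. $[\gamma_1\gamma_2]-[\gamma_1m\gamma_2]=[\gamma_1][\gamma_2]$ for $\gamma_1,\gamma_2\in\pi_K$. Let $\mathbb F$ be a field. An augmentation is a unital ring homomorphism $\epsilon:\mathcal C_K\to\mathbb F$. A KCH representation is a homomorphism $\rho:\pi_K\to\mathrm{GL}(V)$, $V$ an $\mathbb F$-vector space, such that $\rho(m)$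 is diagonalizable and its eigenvalue $1$ has multiplicity $\dim V-1$ (that is, the $1$-eigenspace has codimension one); it is a KCH irrep if it is moreover irreducible. A KCH representation $\rho$ induces the augmentation $\epsilon_\rho$ given by $$\epsilon_\rho(\mu)=\mu_0,\qquad \epsilon_\rho(\lambda)=\lambda_0,\qquad \epsilon_\rho([\gamma])=(1-\mu_0)\,\langle\rho(\gamma)e_1,e_1\rangle\quad(\gamma\in\pi_K),$$ where $e_1$ is an eigenvector of $\rho(m)$ with eigenvalue $\mu_0\neq1$, $\rho(\ell)e_1=\lambda_0e_1$, and $\langle v,e_1\rangle$ denotes the coefficient of $e_1$ when $v$ is expanded in a basis of eigenvectors of $\rho(m)$ containing $e_1$. **Theorem.** Let $\epsilon:\mathcal C_K\to\mathbb F$ be an augmentation with $\epsilon(\mu)\neq1$. Then there is a KCH irrep $\rho:\pi_K\to\mathrm{GL}(V)$ with $\epsilon_\rho=\epsilon$, and every KCH irrep $\rho':\pi_K\to\mathrm{GL}(V')$ with $\epsilon_{\rho'}=\epsilon$ satisfies $\dim V'=\dim V$. Moreover $\rho$ is given explicitly as follows. Let $\Gamma=(\gamma_1,\dots,\gamma_r)$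 be any finite family in $\pi_K$ with $\gamma_1=e$ such that the meridians $\gamma_i^{-1}m\gamma_i$, $1\le i\le r$, generate $\pi_K$, and let $\mathcal E(\Gamma)$ be the $r\times r$ matrix with entries $\epsilon([\gamma_i\gamma_j^{-1}])$. Then $\dim V=\operatorname{rank}\mathcal E(\Gamma)$, and $\rho$ is isomorphic to the representation on the column space of $\mathcal E(\Gamma)\subset\mathbb F^r$ in which $g\in\pi_K$ sends the $j$-th column $\bigl(\epsilon([\gamma_i\gamma_j^{-1}])\bigr)_{1\le i\le r}$ to $\bigl(\epsilon([\gamma_i\,g\,\gamma_j^{-1}])\bigr)_{1\le i\le r}$ for $j=1,\dots,r$. -/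

import Mathlib

universe u v

/-! ### Knots, tubular neighbourhoods, the knot group and its peripheral elements -/

/-- Euclidean three-space. -/
abbrev E3 : Type := EuclideanSpace ℝ (Fin 3)

/-- A (tame, parametrized, hence oriented) knot in `ℝ³`: a map `S¹ → ℝ³` whose image is the core
of an open solid torus `S¹ × ℂ` topologically embedded in `ℝ³`. In particular it is a topological
embedding; smooth knots and polygonal knots are of this kind. -/
structure TameKnot where
  /-- the parametrization -/
  toFun : Circle → E3
  /-- local flatness, in the form of the existence of a tubular neighbourhood -/
  tame : ∃ Φ : Circle × ℂ → E3, Topology.IsOpenEmbedding Φ ∧ ∀ z, Φ (z, 0) = toFun z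

/-- A parametrized open tubular neighbourhood of the knot `K`. -/
structure Tube (K : TameKnot) where
  /-- the parametrization of the neighbourhood by `S¹ × ℂ` -/
  toFun : Circle × ℂ → E3
  isOpenEmbedding : Topology.IsOpenEmbedding toFun
  core : ∀ z, toFun (z, 0) = K.toFun z

namespace Tube

variable {K : TameKnot} (T : Tube K)

/-- The open solid torus `n(K)` around `K` swept out by the unit discs. -/
def nbhd : Set E3 := T.toFun '' {p | ‖p.2‖ < 1}

/-- The exterior `ℝ³ ∖ n(K)` of the knot. -/
abbrev Exterior : Type := ↥(T.nbhdᶜ)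

theorem mem_exterior (z w : Circle) : T.toFun (z, (w : ℂ)) ∈ T.nbhdᶜ := by
  rintro ⟨p, hp, h⟩
  have h' := T.isOpenEmbedding.injective h
  rw [h', Set.mem_ofPred_eq, Circle.norm_coe] at hp
  exact lt_irrefl _ hp

/-- The boundary torus `S¹ × S¹` inside the exterior. -/
noncomputable def torus (p : Circle × Circle) : T.Exterior :=
  ⟨T.toFun (p.1, (p.2 : ℂ)), T.mem_exterior p.1 p.2⟩

theorem continuous_torus : Continuous T.torus := by
  refine Continuous.subtype_mk (T.isOpenEmbedding.continuous.comp ?_) _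
  fun_prop

/-- The base point, on the boundary torus. -/
noncomputable def base : T.Exterior := T.torus (1, 1)

/-- The knot group `π_K`: the fundamental group of the exterior. -/
abbrev KnotGroup : Type := FundamentalGroup T.Exterior T.base

/-- The loop `t ↦ (1, e^{2πit})` on the boundary torus. It bounds the disc `{1} × 𝔻`, which meets
`K` in one interior point. (The parametrization of the tube may preserve or reverse the orientation
of `ℝ³`, so both orientations of the meridian occur.) -/
noncomputable def meridianPath : Path T.base T.base where
  toFun t := T.torus (1, Circle.exp (2 * Real.pi * t))
  continuous_toFun := T.continuous_torus.comp (by fun_prop)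
  source' := by simp [base]
  target' := by simp [base]

/-- The loop `t ↦ (e^{2πit}, 1)` on the boundary torus, which runs once along `K`. -/
noncomputable def longitudePath : Path T.base T.base where
  toFun t := T.torus (Circle.exp (2 * Real.pi * t), 1)
  continuous_toFun := T.continuous_torus.comp (by fun_prop)
  source' := by simp [base]
  target' := by simp [base]

/-- The meridian `m ∈ π_K`. -/
noncomputable def meridian : T.KnotGroup :=
  FundamentalGroup.fromPath (Path.Homotopic.Quotient.mk T.meridianPath)

/-- The longitude `ℓ ∈ π_K` determined by the parametrization of the tube. -/
noncomputable def longitude : T.KnotGroup :=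
  FundamentalGroup.fromPath (Path.Homotopic.Quotient.mk T.longitudePath)

/-- The tube is Seifert framed, that is, `T.longitude` is the preferred longitude: it vanishes in
the first homology group `H₁ = π_K / [π_K, π_K]` of the exterior. -/
def IsSeifertFramed : Prop := T.longitude ∈ commutator T.KnotGroup

end Tube

/-! ### The cord algebra -/

/-- The ring `R₀ = ℤ[λ^{±1}, μ^{±1}]`. -/
noncomputable abbrev R0 : Type := LaurentPolynomial (LaurentPolynomial ℤ)

/-- The Laurent variable `λ` of `R₀`. -/
noncomputable def lam : R0 := LaurentPolynomial.C (LaurentPolynomial.T 1)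

/-- The Laurent variable `μ` of `R₀`. -/
noncomputable def mu : R0 := LaurentPolynomial.T 1

section CordAlgebra

variable {G : Type*} [Group G]

/-- The generator of the free noncommutative `R₀`-algebra on the set `G` given by `g`. -/
noncomputable abbrev gen (g : G) : FreeAlgebra R0 G := FreeAlgebra.ι R0 g

/-- The defining relations of the cord algebra. -/
inductive CordRel (m l : G) : FreeAlgebra R0 G → FreeAlgebra R0 G → Prop
  | one : CordRel m l (gen 1) (algebraMap R0 _ (1 - mu))
  | mer_left (g : G) : CordRel m l (gen (m * g)) (mu • gen g)
  | mer_right (g : G) : CordRel m l (gen (g * m)) (mu • gen g)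
  | lon_left (g : G) : CordRel m l (gen (l * g)) (lam • gen g)
  | lon_right (g : G) : CordRel m l (gen (g * l)) (lam • gen g)
  | skein (g h : G) : CordRel m l (gen (g * h) - gen (g * m * h)) (gen g * gen h)

/-- The cord algebra: the noncommutative unital `R₀`-algebra generated by symbols `[g]`, `g ∈ G`,
modulo the relations `CordRel`; here `m` is the meridian and `l` the preferred longitude. -/
abbrev CordAlgebra (m l : G) : Type _ := RingQuot (CordRel m l)

/-- The class `[g]` in the cord algebra. -/
noncomputable def cord (m l g : G) : CordAlgebra m l :=
  RingQuot.mkAlgHom R0 (CordRel m l) (gen g)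

end CordAlgebra

/-- The cord algebra `C_K` of the knot `K`. -/
abbrev Tube.CordAlg {K : TameKnot} (T : Tube K) : Type :=
  CordAlgebra T.meridian T.longitude

/-- The class `[g] ∈ C_K` of `g ∈ π_K`. -/
noncomputable abbrev Tube.cls {K : TameKnot} (T : Tube K) (g : T.KnotGroup) : T.CordAlg :=
  cord T.meridian T.longitude g

/-! ### KCH representations and the augmentations that they induce -/

section KCH

variable {F : Type*} [Field F] {G : Type*} [Group G] {V : Type*} [AddCommGroup V] [Module F V]

/-- `ρ` is a KCH representation: `ρ(m)` is diagonalizable, and its eigenvalue `1` has multiplicity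
`dim V - 1`, that is, the `1`-eigenspace has codimension one. -/
def IsKCH (m : G) (ρ : Representation F G V) : Prop :=
  (⨆ a : F, Module.End.eigenspace (ρ m) a) = ⊤ ∧
    Module.finrank F (V ⧸ Module.End.eigenspace (ρ m) 1) = 1

/-- `ρ` is a KCH irrep. -/
def IsKCHIrrep (m : G) (ρ : Representation F G V) : Prop :=
  IsKCH m ρ ∧ ρ.IsIrreducible

/-- `ε = ε_ρ`, the augmentation induced by the KCH representation `ρ`. Here `e` is an eigenvector of
`ρ(m)` with eigenvalue `μ₀ ≠ 1`, `λ₀` is the corresponding eigenvalue of `ρ(ℓ)`, and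
`φ = ⟨·, e⟩` is the coordinate of `e` in a basis of eigenvectors of `ρ(m)` containing `e`;
then `ε_ρ(μ) = μ₀`, `ε_ρ(λ) = λ₀` and `ε_ρ([g]) = (1 - μ₀)⟨ρ(g)e, e⟩`. -/
def Induces (m l : G) (ρ : Representation F G V) (ε : CordAlgebra m l →+* F) : Prop :=
  ∃ (μ₀ l₀ : F) (e : V) (φ : V →ₗ[F] F),
    μ₀ ≠ 1 ∧ ρ m e = μ₀ • e ∧ ρ l e = l₀ • e ∧
    φ e = 1 ∧ (∀ v, ρ m v = v → φ v = 0) ∧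
    ε (algebraMap R0 _ mu) = μ₀ ∧ ε (algebraMap R0 _ lam) = l₀ ∧
    ∀ g, ε (cord m l g) = (1 - μ₀) * φ (ρ g e)

end KCH

/-- The matrix `E(Γ)` of the augmentation `ε`, with entries `ε([γ_i γ_j⁻¹])`. -/
noncomputable def augMatrix {F : Type*} [Field F] {K : TameKnot} (T : Tube K)
    (ε : T.CordAlg →+* F) {n : ℕ} (γ : Fin n → T.KnotGroup) : Matrix (Fin n) (Fin n) F :=
  Matrix.of fun i j => ε (T.cls (γ i * (γ j)⁻¹))

/-! Let π_K act by right translation on the span of the translates of f(g) = ε([g]). The skein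
relation makes the meridian a rank one perturbation of the identity, m·v = v - v(1)f
(`augRep_meridian`). As f(1) = 1 - μ ≠ 0, its 1-eigenspace is {v(1) = 0}, and f spans a complement
with eigenvalue μ.

The same formula recovers f from any nonzero vector, which gives irreducibility. Conversely, the
matrix coefficients of an irrep inducing ε map it isomorphically onto this space, so even the
isomorphism class is unique.

The conjugate γ⁻¹mγ acts by v ↦ v - v(γ)(γ⁻¹·f). If such conjugates generate, a v vanishing on Γ is
invariant, hence zero, and the γ_j⁻¹·f span. Restriction to Γ is thus an isomorphism onto the column
space of E(Γ). -/

/-! ### The cyclic representation generated by a function -/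

section RightTranslation

variable (F G : Type*) [Field F] [Group G]

/-- The right regular representation of `G` on all functions `G → F`. -/
def rightTranslation : Representation F G (G → F) where
  toFun g := LinearMap.funLeft F F fun x => x * g
  map_one' := by ext; simp [LinearMap.funLeft_apply]
  map_mul' g h := by ext; simp [LinearMap.funLeft_apply, mul_assoc]

variable {F G}

@[simp]
theorem rightTranslation_apply (g : G) (v : G → F) (x : G) :
    rightTranslation F G g v x = v (x * g) := rfl

/-- The subrepresentation of the right regular representation generated by a function. -/
def translates (f : G → F) : Subrepresentation (rightTranslation F G) where
  toSubmodule := Submodule.span F (Set.range fun g => rightTranslation F G g f)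
  apply_mem_toSubmodule g v hv := by
    induction hv using Submodule.span_induction with
    | mem x hx =>
      obtain ⟨h, rfl⟩ := hx
      exact Submodule.subset_span ⟨g * h, by simp⟩
    | zero => simp
    | add x y _ _ hx hy => rw [map_add]; exact add_mem hx hy
    | smul a x _ hx => rw [map_smul]; exact Submodule.smul_mem _ _ hx

/-- The function `f` itself, as a vector of `translates f`. -/
def translatesGen (f : G → F) : (translates f).toSubmodule :=
  ⟨f, Submodule.subset_span ⟨1, by simp⟩⟩

/-- The restriction of the right regular representation to the translates of `f`. -/
abbrev translatesRep (f : G → F) : Representation F G (translates f).toSubmodule :=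
  (translates f).toRepresentation

/-- The translates of `f` span. With `W` a kernel, this reduces an identity of linear maps to these
vectors. -/
theorem eq_top_of_translatesGen_mem {f : G → F} (W : Submodule F (translates f).toSubmodule)
    (h : ∀ g, translatesRep f g (translatesGen f) ∈ W) : W = ⊤ := by
  rw [← Submodule.map_injective_of_injective (translates f).toSubmodule.injective_subtype |>.eq_iff,
    Submodule.map_subtype_top]
  refine le_antisymm (Submodule.map_subtype_le _ _) (Submodule.span_le.2 ?_)
  rintro _ ⟨g, rfl⟩
  exact ⟨_, h g, rfl⟩

end RightTranslation

/-! ### Stability and invariance tested on generators -/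

section Generation

variable {F G : Type*} [Field F] [Group G] {V : Type*} [AddCommGroup V] [Module F V]

/-- A submodule stable under the elements of a generating set and their inverses is stable under
the whole group. -/
theorem Representation.apply_mem_of_closure_eq_top (ρ : Representation F G V) {s : Set G}
    (hs : Subgroup.closure s = ⊤) (W : Submodule F V) (h : ∀ g ∈ s, ∀ v ∈ W, ρ g v ∈ W)
    (h' : ∀ g ∈ s, ∀ v ∈ W, ρ g⁻¹ v ∈ W) (g : G) : ∀ v ∈ W, ρ g v ∈ W := by
  have hg : g ∈ Subgroup.closure s := hs ▸ Subgroup.mem_top g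
  induction hg using Subgroup.closure_induction'' with
  | mem x hx => exact h x hx
  | inv_mem x hx => exact h' x hx
  | one => simp
  | mul x y _ _ hx hy => intro v hv; rw [map_mul]; exact hx _ (hy v hv)

/-- A vector fixed by a generating set is fixed by the whole group. -/
theorem Representation.apply_eq_self_of_closure_eq_top (ρ : Representation F G V) {s : Set G}
    (hs : Subgroup.closure s = ⊤) {v : V} (h : ∀ g ∈ s, ρ g v = v) (g : G) : ρ g v = v := by
  have hg : g ∈ Subgroup.closure s := hs ▸ Subgroup.mem_top g
  induction hg using Subgroup.closure_induction with
  | mem x hx => exact h x hx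
  | one => simp
  | mul x y _ _ hx hy => rw [map_mul, Module.End.mul_apply, hy, hx]
  | inv x _ hx => nth_rw 1 [← hx]; simp

end Generation

/-! ### The representation attached to an augmentation -/

section Augmentation

variable {F : Type*} [Field F] {G : Type*} [Group G] {m l : G} (ε : CordAlgebra m l →+* F)

/-- The ring homomorphism on the free algebra that lifts `ε`. -/
noncomputable def augLift : FreeAlgebra R0 G →+* F :=
  ε.comp (RingQuot.mkAlgHom R0 (CordRel m l)).toRingHom

theorem augLift_gen (g : G) : augLift ε (gen g) = ε (cord m l g) := rfl

theorem augLift_algebraMap (r : R0) :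
    augLift ε (algebraMap R0 _ r) = ε (algebraMap R0 _ r) :=
  congrArg ε ((RingQuot.mkAlgHom R0 (CordRel m l)).commutes r)

theorem augLift_smul (r : R0) (a : FreeAlgebra R0 G) :
    augLift ε (r • a) = ε (algebraMap R0 _ r) * augLift ε a := by
  rw [← augLift_algebraMap, ← map_mul]
  exact congrArg (augLift ε) (Algebra.smul_def r a)

theorem augLift_rel {a b : FreeAlgebra R0 G} (h : CordRel m l a b) :
    augLift ε a = augLift ε b :=
  congrArg ε (RingQuot.mkAlgHom_rel R0 h)

theorem aug_one : ε (cord m l 1) = 1 - ε (algebraMap R0 _ mu) := by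
  have h := augLift_rel ε .one
  rw [augLift_gen] at h
  rw [h, ← augLift_algebraMap, ← RingHom.comp_apply, ← RingHom.comp_apply, map_sub, map_one]

theorem aug_mul_longitude (g : G) :
    ε (cord m l (g * l)) = ε (algebraMap R0 _ lam) * ε (cord m l g) := by
  rw [← augLift_gen, augLift_rel ε (.lon_right g), augLift_smul, augLift_gen]

/-- The skein relation, solved for the term containing `m`; it governs the action of every meridian.
-/
theorem aug_mul_meridian_mul (g h : G) :
    ε (cord m l (g * m * h)) = ε (cord m l (g * h)) - ε (cord m l g) * ε (cord m l h) := by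
  rw [← augLift_gen, ← augLift_gen, ← augLift_gen, ← augLift_gen, ← map_mul,
    ← augLift_rel ε (.skein g h), map_sub, sub_sub_cancel]

/-- The function `g ↦ ε([g])` on the group. -/
noncomputable def augFun (g : G) : F := ε (cord m l g)

/-- The space of the representation of the augmentation `ε`: the span of the right translates of
the function `g ↦ ε([g])`. -/
noncomputable abbrev AugSpace : Type _ := (translates (augFun ε)).toSubmodule

/-- The representation of the augmentation `ε`, by right translation on `AugSpace ε`. -/
noncomputable abbrev augRep : Representation F G (AugSpace ε) := translatesRep (augFun ε)

/-- The vector `g ↦ ε([g])` of `AugSpace ε`. -/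
noncomputable abbrev augVec : AugSpace ε := translatesGen (augFun ε)

/-- Evaluation at a group element, as a functional on `AugSpace ε`. -/
noncomputable def augEval (x : G) : AugSpace ε →ₗ[F] F :=
  LinearMap.proj x ∘ₗ (translates (augFun ε)).toSubmodule.subtype

theorem augEval_augRep (x g : G) (v : AugSpace ε) :
    augEval ε x (augRep ε g v) = augEval ε (x * g) v := rfl

theorem augEval_augVec (x : G) : augEval ε x (augVec ε) = ε (cord m l x) := rfl

theorem augSpace_ext {v w : AugSpace ε} (h : ∀ x, augEval ε x v = augEval ε x w) : v = w :=
  Subtype.ext (funext h)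

/-- The meridian acts by a rank one perturbation of the identity. -/
theorem augRep_meridian (v : AugSpace ε) :
    augRep ε m v = v - augEval ε 1 v • augVec ε := by
  suffices H : (augRep ε m : AugSpace ε →ₗ[F] AugSpace ε) =
      LinearMap.id - (augEval ε 1).smulRight (augVec ε) from LinearMap.congr_fun H v
  -- The locus where the two maps agree is a kernel, so the translates of the generator suffice.
  rw [← sub_eq_zero, ← LinearMap.ker_eq_top]
  refine eq_top_of_translatesGen_mem _ fun g => ?_
  rw [LinearMap.mem_ker, LinearMap.sub_apply, sub_eq_zero]
  refine augSpace_ext ε fun x => ?_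
  simp only [LinearMap.sub_apply, LinearMap.id_apply, LinearMap.smulRight_apply, map_sub, map_smul,
    augEval_augRep, augEval_augVec, smul_eq_mul, one_mul]
  rw [aug_mul_meridian_mul, mul_comm (ε (cord m l x))]

/-- Conjugation carries evaluation at 1 to evaluation at `g`, and the generator to its translate by
`g⁻¹`. -/
theorem augRep_conj_meridian (g : G) (v : AugSpace ε) :
    augRep ε (g⁻¹ * m * g) v = v - augEval ε g v • augRep ε g⁻¹ (augVec ε) := by
  rw [map_mul, map_mul, Module.End.mul_apply, Module.End.mul_apply, augRep_meridian, map_sub,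
    map_smul, augEval_augRep, one_mul, Representation.inv_self_apply]

theorem augRep_meridian_augVec :
    augRep ε m (augVec ε) = ε (algebraMap R0 _ mu) • augVec ε :=
  augSpace_ext ε fun x => by
    rw [augRep_meridian, map_sub, map_smul, map_smul, augEval_augVec, augEval_augVec, aug_one,
      smul_eq_mul, smul_eq_mul, sub_mul, one_mul, sub_sub_cancel]

theorem augRep_longitude_augVec :
    augRep ε l (augVec ε) = ε (algebraMap R0 _ lam) • augVec ε :=
  augSpace_ext ε fun x => by
    rw [augEval_augRep, augEval_augVec, map_smul, augEval_augVec, aug_mul_longitude, smul_eq_mul]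

/-! ### Diagonalizability, irreducibility and uniqueness when μ ≠ 1 -/

variable {ε}

theorem augEval_one_augVec_ne_zero (hε : ε (algebraMap R0 _ mu) ≠ 1) :
    augEval ε 1 (augVec ε) ≠ 0 := by
  rw [augEval_augVec, aug_one]
  exact sub_ne_zero.2 hε.symm

theorem augVec_ne_zero (hε : ε (algebraMap R0 _ mu) ≠ 1) : augVec ε ≠ 0 := fun h =>
  augEval_one_augVec_ne_zero hε (by rw [h, map_zero])

theorem augRep_meridian_eq_self_iff (hε : ε (algebraMap R0 _ mu) ≠ 1) (v : AugSpace ε) :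
    augRep ε m v = v ↔ augEval ε 1 v = 0 := by
  rw [augRep_meridian, sub_eq_self, smul_eq_zero, or_iff_left (augVec_ne_zero hε)]

theorem eigenspace_augRep_meridian (hε : ε (algebraMap R0 _ mu) ≠ 1) :
    Module.End.eigenspace (augRep ε m) 1 = LinearMap.ker (augEval ε 1) := by
  ext v
  rw [Module.End.mem_eigenspace_iff, one_smul, augRep_meridian_eq_self_iff hε, LinearMap.mem_ker]

theorem isKCH_augRep (hε : ε (algebraMap R0 _ mu) ≠ 1) : IsKCH m (augRep ε) := by
  have hne := augEval_one_augVec_ne_zero hε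
  constructor
  · rw [eq_top_iff]
    intro v _
    -- This is the coefficient for which `v - c • augVec ε` vanishes at 1, that is, is fixed by `m`.
    set c := augEval ε 1 v / augEval ε 1 (augVec ε) with hc
    rw [← sub_add_cancel v (c • augVec ε)]
    refine add_mem
      (Submodule.mem_iSup_of_mem (p := fun a => Module.End.eigenspace (augRep ε m) a) 1 ?_)
      (Submodule.mem_iSup_of_mem (p := fun a => Module.End.eigenspace (augRep ε m) a)
        (ε (algebraMap R0 _ mu)) ?_)
    · rw [eigenspace_augRep_meridian hε, LinearMap.mem_ker, map_sub, map_smul, smul_eq_mul, hc,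
        div_mul_cancel₀ _ hne, sub_self]
    · exact Submodule.smul_mem _ _
        (Module.End.mem_eigenspace_iff.2 (augRep_meridian_augVec ε))
  · rw [eigenspace_augRep_meridian hε]
    have hsurj : Function.Surjective (augEval ε 1) :=
      LinearMap.surjective fun h => hne (by rw [h, LinearMap.zero_apply])
    rw [((augEval ε 1).quotKerEquivOfSurjective hsurj).finrank_eq, Module.finrank_self]

theorem isIrreducible_augRep (hε : ε (algebraMap R0 _ mu) ≠ 1) :
    (augRep ε).IsIrreducible := by
  have hnt : Nontrivial (Subrepresentation (augRep ε)) := by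
    refine ⟨⊥, ⊤, fun h => augVec_ne_zero hε ?_⟩
    have h' : augVec ε ∈ (⊥ : Subrepresentation (augRep ε)).toSubmodule := by
      rw [h]; exact Submodule.mem_top
    exact (Submodule.mem_bot F).1 h'
  refine ⟨fun W => or_iff_not_imp_left.2 fun hW => ?_⟩
  obtain ⟨v, hv, hv0⟩ : ∃ v ∈ W.toSubmodule, v ≠ 0 :=
    Submodule.exists_mem_ne_zero_of_ne_bot fun h =>
      hW (Subrepresentation.toSubmodule_injective h)
  obtain ⟨x, hx⟩ : ∃ x, augEval ε x v ≠ 0 := by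
    by_contra! h
    exact hv0 (augSpace_ext ε fun x => by rw [h, map_zero])
  -- Translation by `x` moves the nonzero value to 1; subtracting the image under `m` then leaves
  -- `v(x)` times the generator.
  have hxv := W.apply_mem_toSubmodule x hv
  have hmem : augEval ε x v • augVec ε ∈ W.toSubmodule := by
    have h := sub_mem hxv (W.apply_mem_toSubmodule m hxv)
    rwa [augRep_meridian, sub_sub_cancel, augEval_augRep, one_mul] at h
  have hvec : augVec ε ∈ W.toSubmodule := (Submodule.smul_mem_iff _ hx).1 hmem
  exact Subrepresentation.toSubmodule_injective
    (eq_top_of_translatesGen_mem _ fun g => W.apply_mem_toSubmodule g hvec)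

theorem induces_augRep (hε : ε (algebraMap R0 _ mu) ≠ 1) : Induces m l (augRep ε) ε := by
  have hne := augEval_one_augVec_ne_zero hε
  refine ⟨ε (algebraMap R0 _ mu), ε (algebraMap R0 _ lam), augVec ε,
    (augEval ε 1 (augVec ε))⁻¹ • augEval ε 1, hε, augRep_meridian_augVec ε,
    augRep_longitude_augVec ε, ?_, fun v hv => ?_, rfl, rfl, fun g => ?_⟩
  · rw [LinearMap.smul_apply, smul_eq_mul, inv_mul_cancel₀ hne]
  · rw [LinearMap.smul_apply, (augRep_meridian_eq_self_iff hε v).1 hv, smul_zero]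
  · rw [LinearMap.smul_apply, ← aug_one, ← augEval_augVec, ← augEval_augVec, smul_eq_mul,
      mul_inv_cancel_left₀ hne, augEval_augRep, one_mul]

/-- Every irreducible representation inducing `ε` is linearly equivalent to `AugSpace ε`, through
the matrix coefficient map. -/
theorem Induces.exists_linearEquiv {V : Type*} [AddCommGroup V] [Module F V]
    {ρ : Representation F G V} (hirr : ρ.IsIrreducible) (h : Induces m l ρ ε) :
    ∃ Φ : V ≃ₗ[F] AugSpace ε, ∀ g v, Φ (ρ g v) = augRep ε g (Φ v) := by
  obtain ⟨μ₀, l₀, e, φ, hμ, -, -, hφ, -, -, -, hε⟩ := h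
  have he : e ≠ 0 := by rintro rfl; simp at hφ
  have hcyc : Submodule.span F (Set.range fun g => ρ g e) = ⊤ := by
    let W : Subrepresentation ρ := ⟨Submodule.span F (Set.range fun g => ρ g e), fun g v hv => by
      induction hv using Submodule.span_induction with
      | mem x hx =>
        obtain ⟨h, rfl⟩ := hx
        exact Submodule.subset_span ⟨g * h, by simp⟩
      | zero => simp
      | add x y _ _ hx hy => rw [map_add]; exact add_mem hx hy
      | smul a x _ hx => rw [map_smul]; exact Submodule.smul_mem _ _ hx⟩
    have heW : e ∈ W.toSubmodule := Submodule.subset_span ⟨1, by simp⟩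
    rcases hirr.eq_bot_or_eq_top W with hW | hW
    · rw [hW] at heW
      exact absurd ((Submodule.mem_bot F).1 heW) he
    · exact congrArg Subrepresentation.toSubmodule hW
  -- The factor `1 - μ₀` makes `Ψ e` exactly the function `g ↦ ε([g])`.
  let Ψ : V →ₗ[F] (G → F) := LinearMap.pi fun x => (1 - μ₀) • (φ ∘ₗ ρ x)
  have hΨ (v : V) (x : G) : Ψ v x = (1 - μ₀) * φ (ρ x v) := rfl
  have hequiv (g : G) (v : V) : Ψ (ρ g v) = rightTranslation F G g (Ψ v) := by
    ext x
    rw [rightTranslation_apply, hΨ, hΨ, map_mul, Module.End.mul_apply]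
  have hΨe : Ψ e = augFun ε := by
    ext x
    rw [hΨ, augFun, hε]
  -- The kernel is invariant, and it is not everything because `Ψ e` takes the value `1 - μ₀ ≠ 0` at
  -- 1.
  have hinj : Function.Injective Ψ := by
    let N : Subrepresentation ρ := ⟨LinearMap.ker Ψ, fun g v hv => by
      rw [LinearMap.mem_ker] at hv ⊢
      rw [hequiv, hv, map_zero]⟩
    rw [← LinearMap.ker_eq_bot]
    rcases hirr.eq_bot_or_eq_top N with hN | hN
    · exact congrArg Subrepresentation.toSubmodule hN
    · have heN : e ∈ N.toSubmodule := by rw [hN]; exact Submodule.mem_top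
      have h1 := hΨ e 1
      rw [LinearMap.mem_ker.1 heN, map_one, Module.End.one_apply, hφ, mul_one] at h1
      exact absurd h1.symm (sub_ne_zero.2 hμ.symm)
  have hrange : LinearMap.range Ψ = (translates (augFun ε)).toSubmodule := by
    rw [LinearMap.range_eq_map, ← hcyc, Submodule.map_span, ← Set.range_comp]
    congr 2
    ext1 g
    rw [Function.comp_apply, hequiv, hΨe]
  exact ⟨(LinearEquiv.ofInjective Ψ hinj).trans (LinearEquiv.ofEq _ _ hrange),
    fun g v => Subtype.ext (hequiv g v)⟩

/-! ### Restriction to a family of meridional generators -/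

section MeridionalGenerators

variable {ι : Type*} (γ : ι → G)

variable (ε) in
/-- Restriction of functions on the group to a family of group elements. -/
noncomputable def augRestrict : AugSpace ε →ₗ[F] (ι → F) := LinearMap.pi fun i => augEval ε (γ i)

variable {γ}

/-- A function vanishing on the family is fixed by the generating meridians, hence by the group. It
is then constant, with value its value at `γ i₀ = 1`, which is 0. -/
theorem augRestrict_injective {i₀ : ι} (h₀ : γ i₀ = 1)
    (hγ : Subgroup.closure (Set.range fun i => (γ i)⁻¹ * m * γ i) = ⊤) :
    Function.Injective (augRestrict ε γ) := by
  rw [← LinearMap.ker_eq_bot, LinearMap.ker_eq_bot']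
  intro v hv
  have hv' (i : ι) : augEval ε (γ i) v = 0 := congrFun hv i
  have hfix := (augRep ε).apply_eq_self_of_closure_eq_top hγ (v := v) (by
    rintro _ ⟨i, rfl⟩
    rw [augRep_conj_meridian, hv', zero_smul, sub_zero])
  refine augSpace_ext ε fun x => ?_
  rw [← one_mul x, ← augEval_augRep, hfix x, ← h₀, hv', map_zero]

/-- Each generating meridian changes a vector only by a multiple of a spanning one, so the span is
invariant; it contains the cyclic vector because `γ i₀ = 1`. -/
theorem span_augRep_inv_augVec {i₀ : ι} (h₀ : γ i₀ = 1)
    (hγ : Subgroup.closure (Set.range fun i => (γ i)⁻¹ * m * γ i) = ⊤) :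
    Submodule.span F (Set.range fun j => augRep ε (γ j)⁻¹ (augVec ε)) = ⊤ := by
  set W := Submodule.span F (Set.range fun j => augRep ε (γ j)⁻¹ (augVec ε)) with hW
  have hmem (j : ι) : augRep ε (γ j)⁻¹ (augVec ε) ∈ W := Submodule.subset_span ⟨j, rfl⟩
  have hvec : augVec ε ∈ W := by
    have h := hmem i₀
    rwa [h₀, inv_one, map_one, Module.End.one_apply] at h
  refine eq_top_of_translatesGen_mem _ fun g =>
    (augRep ε).apply_mem_of_closure_eq_top hγ W ?_ ?_ g _ hvec
  · rintro _ ⟨i, rfl⟩ v hv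
    rw [augRep_conj_meridian]
    exact sub_mem hv (W.smul_mem _ (hmem i))
  · rintro _ ⟨i, rfl⟩ v hv
    -- Applying the formula to the preimage `w` of `v` shows that `w` differs from `v` by a multiple
    -- of a spanning vector; no finiteness of dimension is needed.
    have h := augRep_conj_meridian ε (γ i) (augRep ε ((γ i)⁻¹ * m * γ i)⁻¹ v)
    rw [Representation.self_inv_apply] at h
    rw [sub_eq_iff_eq_add.1 h.symm]
    exact add_mem hv (W.smul_mem _ (hmem i))

theorem range_augRestrict {i₀ : ι} (h₀ : γ i₀ = 1)
    (hγ : Subgroup.closure (Set.range fun i => (γ i)⁻¹ * m * γ i) = ⊤) :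
    LinearMap.range (augRestrict ε γ) =
      Submodule.span F (Set.range (Matrix.of fun i j => ε (cord m l (γ i * (γ j)⁻¹))).col) := by
  rw [LinearMap.range_eq_map, ← span_augRep_inv_augVec h₀ hγ, Submodule.map_span, ← Set.range_comp]
  rfl

end MeridionalGenerators

end Augmentation

theorem theorem1p2 {F : Type u} [Field F]
    (K : TameKnot) (T : Tube K) (hT : T.IsSeifertFramed)
    (ε : T.CordAlg →+* F) (hε : ε (algebraMap R0 _ mu) ≠ 1) :
    ∃ (V : Type u) (_ : AddCommGroup V) (_ : Module F V) (ρ : Representation F T.KnotGroup V),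
      -- `ρ` is a KCH irrep and `ε_ρ = ε`
      IsKCHIrrep T.meridian ρ ∧ Induces T.meridian T.longitude ρ ε ∧
      -- every KCH irrep inducing `ε` has the dimension of `ρ`
      (∀ (V' : Type v) [AddCommGroup V'] [Module F V'] (ρ' : Representation F T.KnotGroup V'),
        IsKCHIrrep T.meridian ρ' → Induces T.meridian T.longitude ρ' ε →
          Cardinal.lift.{u} (Module.rank F V') = Cardinal.lift.{v} (Module.rank F V)) ∧
      -- for every finite system of meridional generators `γ_i⁻¹ m γ_i`, the dimension is the rank
      -- of `E(Γ)`, and `ρ` is the explicit action on the column space of `E(Γ)`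
      (∀ (r : ℕ) (γ : Fin (r + 1) → T.KnotGroup), γ 0 = 1 →
        Subgroup.closure (Set.range fun i => (γ i)⁻¹ * T.meridian * γ i) = ⊤ →
          Module.rank F V = ((augMatrix T ε γ).rank : Cardinal) ∧
          ∃ Θ : V ≃ₗ[F] Submodule.span F (Set.range (augMatrix T ε γ).col),
            ∀ (g : T.KnotGroup) (j : Fin (r + 1)) (v : V),
              (Θ v : Fin (r + 1) → F) = (augMatrix T ε γ).col j →
              (Θ (ρ g v) : Fin (r + 1) → F) = fun i => ε (T.cls (γ i * g * (γ j)⁻¹))) := by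
  refine ⟨AugSpace ε, inferInstance, inferInstance, augRep ε,
    ⟨isKCH_augRep hε, isIrreducible_augRep hε⟩, induces_augRep hε, ?_, ?_⟩
  · intro V' _ _ ρ' hρ' hind
    obtain ⟨Φ, -⟩ := hind.exists_linearEquiv hρ'.2
    exact Φ.lift_rank_eq
  · intro r γ h₀ hγ
    have hinj := augRestrict_injective (ε := ε) h₀ hγ
    have hrange := range_augRestrict (ε := ε) h₀ hγ
    let Θ : AugSpace ε ≃ₗ[F] Submodule.span F (Set.range (augMatrix T ε γ).col) :=
      (LinearEquiv.ofInjective _ hinj).trans (LinearEquiv.ofEq _ _ hrange)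
    refine ⟨?_, Θ, fun g j v hv => ?_⟩
    · rw [Θ.rank_eq, Matrix.rank_eq_finrank_span_cols, Module.finrank_eq_rank]
    -- Injectivity of restriction identifies the only vector lying over column `j`.
    · have hv' : v = augRep ε (γ j)⁻¹ (augVec ε) := hinj hv
      ext i
      rw [hv', ← Module.End.mul_apply, ← map_mul, mul_assoc]
      rfl
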